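/- For a non-negative integer $n$, let $\overline{B}_{2,9}(n)$ denote the number of $(2,9)$-biregular overpartitions of $n$, i.e. of partitions of $n$ in which the first occurrence of each part may be overlined and in which no part is divisible by $2$ or by $9$ (so $\overline{B}_{2,9}(0)=1$). Let $p$ be a prime with $p\equiv 5\pmod 6$. (i) For every positive integer $k$ and all non-negative integers $n$ and $r$ such that $p$ divides $6r+5$, $$\overline{B}_{2,9}\left(6p^{k+1}n+6pr+5p\right)\equiv (-p)\cdot\overline{B}_{2,9}\left(6p^{k-1}n+\frac{6r+5}{p}\right)\pmod 8.$$ (ii) For every positive integer $k$ and every non-negative integer $n$, $$\overline{B}_{2,9}\left(6p^{2k}n+p^{2k}\right)\equiv(-p)^k\,\overline{B}_{2,9}(6n+1)\pmod 8.$$ -/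

import Mathlib

/-- An overpartition of `n`: a partition of `n` in which the first occurrence of each
part size may be overlined. It is recorded as a partition of `n` together with the finite set of
those part sizes whose first occurrence is overlined. -/
@[ext]
structure Overpartition (n : ℕ) where
  /-- the underlying partition -/
  partition : n.Partition
  /-- the part sizes whose first occurrence is overlined -/
  overlined : Finset ℕ
  /-- only part sizes that occur can be overlined -/
  overlined_mem : ∀ i ∈ overlined, i ∈ partition.parts

/-- There are finitely many overpartitions of `n`, so counting them with `Nat.card` is meaningful. -/
instance Overpartition.instFinite (n : ℕ) : Finite (Overpartition n) := by
  let f : Overpartition n → n.Partition × (Finset.range (n + 1)).powerset := fun x =>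
    (x.partition, ⟨x.overlined, Finset.mem_powerset.2 fun i hi => Finset.mem_range.2
      (Nat.lt_succ_of_le (Nat.Partition.le_of_mem_parts (x.overlined_mem i hi)))⟩)
  refine Finite.of_injective f fun x y h => ?_
  have h₁ : x.partition = y.partition := congrArg Prod.fst h
  have h₂ : x.overlined = y.overlined := congrArg (fun z => (z.2 : Finset ℕ)) h
  exact Overpartition.ext h₁ h₂

/-- An overpartition is `(l₁, l₂)`-biregular if none of its parts is divisible by `l₁` or `l₂`. -/
def Overpartition.IsBiregular (l₁ l₂ : ℕ) {n : ℕ} (x : Overpartition n) : Prop :=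
  ∀ i ∈ x.partition.parts, ¬ l₁ ∣ i ∧ ¬ l₂ ∣ i

/-- The number of `(l₁, l₂)`-biregular overpartitions of `n`. -/
noncomputable def biregularOverpartitionCount (l₁ l₂ n : ℕ) : ℕ :=
  Nat.card {x : Overpartition n // x.IsBiregular l₁ l₂}

/-!
By Gauss's square theorem `∏ (1 - q ^ i) / (1 + q ^ i) = φ(-q)`, the series `∑ B(n) q ^ n` is the
theta quotient `φ(-q ^ 2) φ(-q ^ 9) / (φ(-q) φ(-q ^ 18))`. Writing `φ(-q) = φ(-q ^ 9) + 2 x(q)`,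
where all exponents of `x` are `1` modulo `3`, and reducing the quotient modulo `8`, one finds
`2 B(m) ≡ r₂(m)` modulo `16` for `m ≡ 1` modulo `6`, where `r₂` counts representations as a sum of
two squares; comparing with `φ(-q) ^ 2` also gives `8 ∣ r₂(m)` for `m ≡ 5` modulo `6`. Unique
factorization in `ℤ[i]` expresses `r₂(p ^ 2 m)` through `r₂(m)` and `r₂(p m)`, and the last term
drops out because `p m ≡ 5` modulo `6`.
-/

open PowerSeries
open scoped PowerSeries.WithPiTopology

section OverpartitionSeries

theorem card_overpartition_eq_sum (S : Set ℕ) [DecidablePred (· ∈ S)] (n : ℕ) :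
    Nat.card {x : Overpartition n // ∀ i ∈ x.partition.parts, i ∈ S} =
      ∑ p : n.Partition, if ∀ i ∈ p.parts, i ∈ S then 2 ^ p.parts.toFinset.card else 0 := by
  let e : {x : Overpartition n // ∀ i ∈ x.partition.parts, i ∈ S} ≃
      Σ p : {p : n.Partition // ∀ i ∈ p.parts, i ∈ S}, p.1.parts.toFinset.powerset :=
    { toFun := fun x => ⟨⟨x.1.partition, x.2⟩, ⟨x.1.overlined, by
        simpa [Finset.subset_iff] using x.1.overlined_mem⟩⟩
      invFun := fun y => ⟨⟨y.1.1, y.2.1, fun i hi => by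
        simpa using Finset.mem_powerset.1 y.2.2 hi⟩, y.1.2⟩
      left_inv := fun _ => rfl
      right_inv := fun _ => rfl }
  rw [Nat.card_congr e, Nat.card_eq_fintype_card, Fintype.card_sigma, ← Finset.sum_filter]
  simp only [Fintype.card_coe, Finset.card_powerset]
  exact (Finset.sum_subtype _ (by simp) fun p : n.Partition => 2 ^ p.parts.toFinset.card).symm

/-- The generating function of the overpartitions all of whose parts lie in `S`: a part size gets
the weight `2`, because it may be overlined or not. -/
noncomputable def overpartitionSeries (S : Set ℕ) : ℤ⟦X⟧ :=
  Nat.Partition.genFun fun i _ => S.indicator 2 i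

theorem coeff_overpartitionSeries (S : Set ℕ) (n : ℕ) :
    (overpartitionSeries S).coeff n =
      Nat.card {x : Overpartition n // ∀ i ∈ x.partition.parts, i ∈ S} := by
  classical
  simp only [overpartitionSeries, Nat.Partition.coeff_genFun, Finsupp.prod, Set.indicator_apply,
    Multiset.toFinsupp_support, Pi.ofNat_apply, Finset.prod_ite_zero, Multiset.mem_toFinset,
    Finset.prod_const, card_overpartition_eq_sum, Nat.cast_sum, Nat.cast_ite, Nat.cast_pow,
    Nat.cast_ofNat, Nat.cast_zero]

/-- The factor `1 + 2 X ^ n + 2 X ^ (2 n) + ⋯` contributed by the part size `n` to the generating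
function of overpartitions. -/
noncomputable def overpartitionFactor (n : ℕ) : ℤ⟦X⟧ :=
  1 + ∑' j, 2 * X ^ (n * (j + 1))

theorem overpartitionFactor_mul_one_sub {n : ℕ} (hn : n ≠ 0) :
    overpartitionFactor n * (1 - X ^ n) = 1 + X ^ n := by
  have hX : constantCoeff ((X : ℤ⟦X⟧) ^ n) = 0 := by simp [hn]
  have hsum := WithPiTopology.summable_pow_of_constantCoeff_eq_zero hX
  have hgeom := WithPiTopology.tsum_pow_mul_one_sub_of_constantCoeff_eq_zero hX
  have htail : ∑' j, 2 * (X : ℤ⟦X⟧) ^ (n * (j + 1)) = 2 * ∑' j, (X ^ n) ^ (j + 1) := by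
    simp only [pow_mul]
    exact ((summable_nat_add_iff 1).2 hsum).tsum_mul_left 2
  rw [hsum.tsum_eq_zero_add, pow_zero] at hgeom
  rw [overpartitionFactor, htail]
  linear_combination 2 * hgeom

theorem expand_overpartitionFactor {k n : ℕ} (hk : k ≠ 0) (hn : n ≠ 0) :
    expand k hk (overpartitionFactor n) = overpartitionFactor (k * n) := by
  have hkn : k * n ≠ 0 := mul_ne_zero hk hn
  have hne : (1 - X ^ (k * n) : ℤ⟦X⟧) ≠ 0 := fun h => by
    simpa [hkn] using congrArg constantCoeff h
  apply mul_right_cancel₀ hne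
  rw [overpartitionFactor_mul_one_sub hkn]
  simpa [pow_mul] using congrArg (expand k hk) (overpartitionFactor_mul_one_sub hn)

theorem hasProd_overpartitionSeries (S : Set ℕ) :
    HasProd (fun i => S.mulIndicator overpartitionFactor (i + 1)) (overpartitionSeries S) := by
  convert! Nat.Partition.hasProd_genFun fun i _ => S.indicator (2 : ℕ → ℤ) i using 2 with i
  by_cases hi : i + 1 ∈ S <;> simp [hi, overpartitionFactor, smul_eq_C_mul]

theorem overpartitionSeries_compl_union_mul (S T : Set ℕ) :
    overpartitionSeries (S ∪ T)ᶜ * overpartitionSeries S * overpartitionSeries T =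
      overpartitionSeries Set.univ * overpartitionSeries (S ∩ T) := by
  have hprod := hasProd_overpartitionSeries
  refine (((hprod _).mul (hprod S)).mul (hprod T)).unique ?_
  convert! (hprod Set.univ).mul (hprod (S ∩ T)) using 2 with i
  by_cases hS : i + 1 ∈ S <;> by_cases hT : i + 1 ∈ T <;> simp [hS, hT]

theorem continuous_expand {R : Type*} [CommRing R] [TopologicalSpace R] {k : ℕ} (hk : k ≠ 0) :
    Continuous (expand k hk : R⟦X⟧ → R⟦X⟧) := by
  refine continuous_iff_continuousAt.2 fun f =>
    (WithPiTopology.tendsto_iff_coeff_tendsto ..).2 fun n => ?_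
  simp only [coeff_expand]
  split_ifs
  · exact (WithPiTopology.continuous_coeff R _).tendsto f
  · exact tendsto_const_nhds

theorem overpartitionSeries_dvd {k : ℕ} (hk : k ≠ 0) :
    overpartitionSeries {i | k ∣ i} = expand k hk (overpartitionSeries Set.univ) := by
  have hexp := (hasProd_overpartitionSeries Set.univ).map (expand k hk) (continuous_expand hk)
  have hpos (i : ℕ) : k * (i + 1) - 1 + 1 = k * (i + 1) :=
    Nat.sub_add_cancel (Nat.mul_pos hk.bot_lt i.succ_pos)
  have hinj : Function.Injective fun i => k * (i + 1) - 1 := fun a b hab => by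
    have hab : k * (a + 1) = k * (b + 1) :=
      (hpos a).symm.trans ((congrArg (· + 1) hab).trans (hpos b))
    simpa [hk] using hab
  have hmul := (hinj.hasProd_iff fun i hi => ?_).2 (hasProd_overpartitionSeries {i | k ∣ i})
  · refine hmul.unique ?_
    convert! hexp using 1
    ext1 i
    simp [hpos, expand_overpartitionFactor hk]
  · refine Set.mulIndicator_of_notMem (mt (fun h => ?_) hi) _
    obtain ⟨j, hj⟩ : k ∣ i + 1 := h
    obtain ⟨j, rfl⟩ := Nat.exists_eq_succ_of_ne_zero (n := j) (by rintro rfl; simp at hj)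
    exact ⟨j, by simp [← hj]⟩

end OverpartitionSeries

section GaussSquareTheorem

variable {R : Type*} [CommRing R]

/-- The summands of the error term in the finite form of Gauss's square theorem. -/
def gaussRemainder (q : R) (n s : ℕ) : R :=
  (-1) ^ (s + 1) * q ^ ((s + 1) * (n + 1)) * (∏ i ∈ Finset.range s, (1 + q ^ (i + 1))) *
    ∏ i ∈ Finset.Ico (s + 1) n, (1 - q ^ (i + 1))

theorem sum_gaussRemainder_succ (q : R) (n : ℕ) :
    ∑ s ∈ Finset.range n, gaussRemainder q (n + 1) s =
      (1 + q ^ (n + 1)) * ∑ s ∈ Finset.range n, gaussRemainder q n s +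
        q ^ (n + 1) * ∏ i ∈ Finset.range n, (1 - q ^ (i + 1)) -
          (-1) ^ n * q ^ ((n + 1) * (n + 1)) * ∏ i ∈ Finset.range n, (1 + q ^ (i + 1)) := by
  let g (s : ℕ) : R := (-1) ^ s * q ^ ((s + 1) * (n + 1)) *
    (∏ i ∈ Finset.range s, (1 + q ^ (i + 1))) * ∏ i ∈ Finset.Ico s n, (1 - q ^ (i + 1))
  have hstep : ∀ s ∈ Finset.range n, gaussRemainder q (n + 1) s =
      (1 + q ^ (n + 1)) * gaussRemainder q n s + (g s - g (s + 1)) := fun s hs => by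
    have hsn : s < n := Finset.mem_range.1 hs
    simp only [g, gaussRemainder, Finset.prod_Ico_succ_top (Nat.succ_le_of_lt hsn),
      Finset.prod_eq_prod_Ico_succ_bot hsn, Finset.prod_range_succ]
    ring
  rw [Finset.sum_congr rfl hstep, Finset.sum_add_distrib, ← Finset.mul_sum, Finset.sum_range_sub']
  simp only [g, pow_zero, one_mul, zero_add, Finset.prod_range_zero, mul_one, Finset.Ico_self,
    Finset.prod_empty, ← Finset.range_eq_Ico]
  ring

theorem prod_one_add_mul_sum_sq (q : R) (n : ℕ) :
    (∏ i ∈ Finset.range n, (1 + q ^ (i + 1))) *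
        (1 + 2 * ∑ s ∈ Finset.range n, (-1) ^ (s + 1) * q ^ (s + 1) ^ 2) =
      ∏ i ∈ Finset.range n, (1 - q ^ (i + 1)) +
        2 * ∑ s ∈ Finset.range n, gaussRemainder q n s := by
  induction n with
  | zero => simp
  | succ n ih =>
    have hlast : gaussRemainder q (n + 1) n = (-1) ^ (n + 1) * q ^ ((n + 1) * (n + 1 + 1)) *
        ∏ i ∈ Finset.range n, (1 + q ^ (i + 1)) := by simp [gaussRemainder]
    simp only [Finset.sum_range_succ, Finset.prod_range_succ, sum_gaussRemainder_succ, hlast]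
    linear_combination (1 + q ^ (n + 1)) * ih

/-- The series `∑ (-1) ^ x X ^ (x ^ 2)` over `x ≥ 1`; note that `(-1) ^ x = (-1) ^ (x ^ 2)`. -/
noncomputable def halfTheta : ℤ⟦X⟧ :=
  .mk fun n => open Classical in if n ≠ 0 ∧ IsSquare n then (-1) ^ n else 0

/-- Gauss's theta series `φ(-q) = ∑ (-1) ^ x q ^ (x ^ 2)` over all integers `x`. -/
noncomputable def gaussTheta : ℤ⟦X⟧ :=
  1 + 2 * halfTheta

theorem coeff_halfTheta_eq_coeff_sum {n N : ℕ} (h : n ≤ N) :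
    halfTheta.coeff n =
      (∑ s ∈ Finset.range N, (-1) ^ (s + 1) * (X : ℤ⟦X⟧) ^ (s + 1) ^ 2).coeff n := by
  have hsign (s : ℕ) : (-1 : ℤ⟦X⟧) ^ s = C ((-1) ^ s) := by simp
  simp only [halfTheta, coeff_mk, map_sum, hsign, coeff_C_mul, coeff_X_pow, mul_ite, mul_one,
    mul_zero]
  split_ifs with hn
  · obtain ⟨hn, x, rfl⟩ := hn
    obtain ⟨x, rfl⟩ := Nat.exists_eq_succ_of_ne_zero (left_ne_zero_of_mul hn)
    have hparity : (-1 : ℤ) ^ (x.succ * x.succ) = (-1) ^ (x + 1) :=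
      neg_one_pow_congr (by simp [Nat.even_mul])
    rw [hparity, Finset.sum_eq_single_of_mem x (Finset.mem_range.2 (by nlinarith))
      fun s _ hs => if_neg fun he => hs ?_, if_pos (sq _).symm]
    rw [← sq] at he
    simpa using (Nat.pow_left_injective two_ne_zero he).symm
  · refine (Finset.sum_eq_zero fun s _ => if_neg ?_).symm
    rintro rfl
    exact hn ⟨by positivity, IsSquare.sq _⟩

theorem tendsto_sum_gaussTheta :
    Filter.Tendsto (fun N => 1 + 2 * ∑ s ∈ Finset.range N,
      (-1) ^ (s + 1) * (X : ℤ⟦X⟧) ^ (s + 1) ^ 2) Filter.atTop (nhds gaussTheta) := by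
  refine .const_add _ (.const_mul _ ?_)
  rw [WithPiTopology.tendsto_iff_coeff_tendsto]
  exact fun n => tendsto_atTop_of_eventually_const (i₀ := n) fun N hN =>
    (coeff_halfTheta_eq_coeff_sum hN).symm

theorem tendsto_sum_gaussRemainder :
    Filter.Tendsto (fun N => ∑ s ∈ Finset.range N, gaussRemainder (X : ℤ⟦X⟧) N s) Filter.atTop
      (nhds 0) := by
  rw [WithPiTopology.tendsto_iff_coeff_tendsto]
  refine fun n => tendsto_atTop_of_eventually_const (i₀ := n) fun N hN => ?_
  have hdvd : (X : ℤ⟦X⟧) ^ (N + 1) ∣ ∑ s ∈ Finset.range N, gaussRemainder X N s :=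
    Finset.dvd_sum fun s _ =>
      (((pow_dvd_pow X (Nat.le_mul_of_pos_left _ s.succ_pos)).mul_left _).mul_right _).mul_right _
  rw [X_pow_dvd_iff.1 hdvd n (Nat.lt_succ_of_le hN), map_zero]

/-- **Gauss's square theorem**: `φ(-q) = ∏ (1 - q ^ i) / (1 + q ^ i)`. -/
theorem overpartitionSeries_univ_mul_gaussTheta :
    overpartitionSeries Set.univ * gaussTheta = 1 := by
  have hG := (hasProd_overpartitionSeries Set.univ).tendsto_prod_nat
  have hM := (WithPiTopology.multipliable_one_sub_X_pow ℤ).hasProd.tendsto_prod_nat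
  refine mul_right_cancel₀ (WithPiTopology.tprod_one_sub_X_pow_ne_zero ℤ) ?_
  refine tendsto_nhds_unique ((hG.mul tendsto_sum_gaussTheta).mul hM) ?_
  convert! hM.add (tendsto_sum_gaussRemainder.const_mul 2) using 2 with N
  · rw [← prod_one_add_mul_sum_sq, mul_right_comm, ← Finset.prod_mul_distrib]
    simp [overpartitionFactor_mul_one_sub]
  · simp

end GaussSquareTheorem

/-- The generating function of the `(l₁, l₂)`-biregular overpartitions. -/
noncomputable def biregularSeries (l₁ l₂ : ℕ) : ℤ⟦X⟧ :=
  .mk fun n => biregularOverpartitionCount l₁ l₂ n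

theorem biregularSeries_eq_overpartitionSeries (l₁ l₂ : ℕ) :
    biregularSeries l₁ l₂ = overpartitionSeries ({i | l₁ ∣ i} ∪ {i | l₂ ∣ i})ᶜ := by
  ext n
  simp [biregularSeries, coeff_overpartitionSeries, biregularOverpartitionCount,
    Overpartition.IsBiregular]

theorem biregularSeries_mul_gaussTheta {l₁ l₂ : ℕ} (h₁ : l₁ ≠ 0) (h₂ : l₂ ≠ 0)
    (hl : l₁.Coprime l₂) :
    biregularSeries l₁ l₂ * gaussTheta * expand (l₁ * l₂) (mul_ne_zero h₁ h₂) gaussTheta =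
      expand l₁ h₁ gaussTheta * expand l₂ h₂ gaussTheta := by
  have hinv {k : ℕ} (hk : k ≠ 0) :
      overpartitionSeries {i | k ∣ i} * expand k hk gaussTheta = 1 := by
    rw [overpartitionSeries_dvd hk, ← map_mul, overpartitionSeries_univ_mul_gaussTheta, map_one]
  have hinter : {i | l₁ ∣ i} ∩ {i | l₂ ∣ i} = {i | l₁ * l₂ ∣ i} :=
    Set.ext fun _ => ⟨fun h => hl.mul_dvd_of_dvd_of_dvd h.1 h.2,
      fun h => ⟨dvd_of_mul_right_dvd h, dvd_of_mul_left_dvd h⟩⟩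
  have hmul := overpartitionSeries_compl_union_mul {i | l₁ ∣ i} {i | l₂ ∣ i}
  rw [← biregularSeries_eq_overpartitionSeries, hinter] at hmul
  linear_combination
    (gaussTheta * expand (l₁ * l₂) (mul_ne_zero h₁ h₂) gaussTheta * expand l₁ h₁ gaussTheta *
      expand l₂ h₂ gaussTheta) * hmul -
    biregularSeries l₁ l₂ * gaussTheta * expand (l₁ * l₂) (mul_ne_zero h₁ h₂) gaussTheta *
      (overpartitionSeries {i | l₂ ∣ i} * expand l₂ h₂ gaussTheta * hinv h₁ + hinv h₂) +
    expand l₁ h₁ gaussTheta * expand l₂ h₂ gaussTheta *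
      (overpartitionSeries {i | l₁ * l₂ ∣ i} * expand (l₁ * l₂) (mul_ne_zero h₁ h₂) gaussTheta *
        overpartitionSeries_univ_mul_gaussTheta + hinv (mul_ne_zero h₁ h₂))

section Dissection

/-- All exponents `n` occurring in the power series `f` satisfy `n ≡ r` modulo `d`. -/
def IsSupportedMod {R : Type*} [Semiring R] (d : ℕ) (r : ZMod d) (f : R⟦X⟧) : Prop :=
  ∀ n, f.coeff n ≠ 0 → (n : ZMod d) = r

namespace IsSupportedMod

section Semiring

variable {R : Type*} [Semiring R] {d : ℕ} {r s : ZMod d} {f g : R⟦X⟧}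

theorem coeff_eq_zero (hf : IsSupportedMod d r f) {n : ℕ} (hn : (n : ZMod d) ≠ r) :
    f.coeff n = 0 :=
  not_imp_comm.1 (hf n) hn

theorem mul (hf : IsSupportedMod d r f) (hg : IsSupportedMod d s g) :
    IsSupportedMod d (r + s) (f * g) := fun n hn => by
  rw [coeff_mul] at hn
  obtain ⟨⟨i, j⟩, hij, hne⟩ := Finset.exists_ne_zero_of_sum_ne_zero hn
  rw [← Finset.HasAntidiagonal.mem_antidiagonal.1 hij, Nat.cast_add, hf i (left_ne_zero_of_mul hne),
    hg j (right_ne_zero_of_mul hne)]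

end Semiring

section CommRing

variable {R : Type*} [CommRing R] {d k : ℕ} {r : ZMod d} {f : R⟦X⟧}

theorem expand (hf : IsSupportedMod d r f) (hk : k ≠ 0) :
    IsSupportedMod d (k * r) (expand k hk f) := fun n hn => by
  obtain ⟨m, rfl⟩ : k ∣ n := not_imp_comm.1 (coeff_expand_of_not_dvd k hk f) hn
  rw [coeff_expand_mul] at hn
  rw [Nat.cast_mul, hf m hn]

theorem expand_of_dvd (hdk : d ∣ k) (hk : k ≠ 0) (f : R⟦X⟧) :
    IsSupportedMod d 0 (PowerSeries.expand k hk f) := fun _ hn =>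
  (ZMod.natCast_eq_zero_iff _ _).2 <| hdk.trans <|
    not_imp_comm.1 (coeff_expand_of_not_dvd k hk f) hn

end CommRing

end IsSupportedMod

theorem coeff_ofNat_mul {R : Type*} [CommSemiring R] (k : ℕ) [k.AtLeastTwo] (f : R⟦X⟧) (n : ℕ) :
    (ofNat(k) * f).coeff n = ofNat(k) * f.coeff n := by
  rw [← map_ofNat (C (R := R)), coeff_C_mul]

/-- The part `∑ (-1) ^ x X ^ (x ^ 2)`, over the `x ≥ 1` not divisible by `3`, of `halfTheta`. -/
noncomputable def halfThetaPrimeToThree : ℤ⟦X⟧ :=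
  halfTheta - expand 9 (by decide) halfTheta

theorem coeff_halfTheta_nine_mul (n : ℕ) : halfTheta.coeff (9 * n) = halfTheta.coeff n := by
  have hsquare : IsSquare (9 * n) ↔ IsSquare n := by
    refine ⟨fun ⟨x, hx⟩ => ?_, fun h => (IsSquare.mul ⟨3, rfl⟩ h)⟩
    obtain ⟨y, rfl⟩ : 3 ∣ x := Nat.prime_three.dvd_of_dvd_pow (n := 2) ⟨3 * n, by linarith⟩
    exact ⟨y, by linarith⟩
  have hsign : (-1 : ℤ) ^ (9 * n) = (-1) ^ n := by rw [pow_mul]; norm_num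
  simp only [halfTheta, coeff_mk, hsquare, hsign, ne_eq, mul_eq_zero, OfNat.ofNat_ne_zero, false_or]

theorem isSupportedMod_halfThetaPrimeToThree : IsSupportedMod 3 1 halfThetaPrimeToThree := by
  intro n hn
  by_cases h9 : 9 ∣ n
  · obtain ⟨m, rfl⟩ := h9
    simp [halfThetaPrimeToThree, coeff_halfTheta_nine_mul] at hn
  · rw [halfThetaPrimeToThree, map_sub, coeff_expand_of_not_dvd _ _ _ h9, sub_zero, halfTheta,
      coeff_mk, ne_eq, ite_eq_right_iff, not_forall] at hn
    obtain ⟨⟨-, x, rfl⟩, -⟩ := hn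
    have hx : (x : ZMod 3) ≠ 0 := fun h => h9 <| by
      have := (ZMod.natCast_eq_zero_iff _ _).1 h
      exact mul_dvd_mul this this
    push_cast
    revert hx
    generalize (x : ZMod 3) = y
    decide +revert

theorem gaussTheta_eq_expand_add :
    gaussTheta = expand 9 (by decide) gaussTheta + 2 * halfThetaPrimeToThree := by
  simp only [gaussTheta, halfThetaPrimeToThree, map_add, map_one, map_mul, map_ofNat]
  ring

theorem isCoprime_eight_one_add_two_mul {R : Type*} [CommRing R] (a : R) :
    IsCoprime 8 (1 + 2 * a) := by
  have h : IsCoprime 2 (1 + 2 * a) := ⟨-a, 1, by ring⟩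
  convert! (h.pow_left : IsCoprime (2 ^ 3) (1 + 2 * a))
  norm_num

theorem eight_dvd_sub_of_mul_eq {R : Type*} [CommRing R] {B C D x y : R} (hC : 2 ∣ C - 1)
    (hD : 2 ∣ D - 1) (h : B * (C + 2 * x) * D = (D + 2 * y) * C) :
    8 ∣ B - (1 - 2 * (x * C) + 4 * (x * x) + 2 * (y * D) - 4 * (x * y)) := by
  -- Expand `B = (1 + 2 y / D) / (1 + 2 x / C)` in powers of `2`, using `C⁻¹ ≡ C` and `D⁻¹ ≡ D`
  -- modulo `4`.
  obtain ⟨c, hc⟩ := hC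
  obtain ⟨d, hd⟩ := hD
  obtain rfl : C = 1 + 2 * c := by linear_combination hc
  obtain rfl : D = 1 + 2 * d := by linear_combination hd
  have hcop := (isCoprime_eight_one_add_two_mul (c + x)).mul_right
    (isCoprime_eight_one_add_two_mul d)
  refine hcop.dvd_of_dvd_mul_right
    ⟨x * (c + c ^ 2) * (1 + 2 * d) - x ^ 3 * (1 + 2 * d) - y * (d + d ^ 2) * (1 + 2 * c) -
      x * y * (d - c) * (1 + 2 * d) + x ^ 2 * y * (1 + 2 * d), ?_⟩
  linear_combination h

theorem two_dvd_expand_gaussTheta_sub_one {k : ℕ} (hk : k ≠ 0) :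
    2 ∣ expand k hk gaussTheta - 1 :=
  ⟨expand k hk halfTheta, by
    simp only [gaussTheta, map_add, map_one, map_mul, map_ofNat, add_sub_cancel_left]⟩

theorem coeff_biregularSeries_modEq {m : ℕ} (hm : m % 3 = 1) :
    (biregularSeries 2 9).coeff m ≡
      -2 * (halfThetaPrimeToThree * expand 9 (by decide) gaussTheta).coeff m [ZMOD 8] := by
  let x := halfThetaPrimeToThree
  let C := expand 9 (by decide) gaussTheta
  let y := expand 2 two_ne_zero x
  let D := expand 18 (by decide) gaussTheta
  have hmul : biregularSeries 2 9 * (C + 2 * x) * D = (D + 2 * y) * C := by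
    have hφ : gaussTheta = C + 2 * x := gaussTheta_eq_expand_add
    have hφ₂ : expand 2 two_ne_zero gaussTheta = D + 2 * y := by
      rw [hφ, map_add, map_mul, map_ofNat]
      exact congrArg (· + 2 * y) (expand_mul 2 two_ne_zero 9 (by decide) gaussTheta).symm
    rw [← hφ, ← hφ₂]
    exact biregularSeries_mul_gaussTheta two_ne_zero (by decide) (by decide)
  have hx : IsSupportedMod 3 1 x := isSupportedMod_halfThetaPrimeToThree
  have hy : IsSupportedMod 3 (2 * 1) y := hx.expand two_ne_zero
  have hD : IsSupportedMod 3 0 D := .expand_of_dvd (by decide) _ _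
  have hm3 : (m : ZMod 3) = 1 := by rw [← ZMod.natCast_mod, hm, Nat.cast_one]
  have hm0 : m ≠ 0 := by rintro rfl; simp at hm
  obtain ⟨f, hf⟩ : 8 ∣ biregularSeries 2 9 -
      (1 - 2 * (x * C) + 4 * (x * x) + 2 * (y * D) - 4 * (x * y)) :=
    eight_dvd_sub_of_mul_eq (two_dvd_expand_gaussTheta_sub_one _)
      (two_dvd_expand_gaussTheta_sub_one _) hmul
  have hcoeff := congrArg (coeff m) hf
  simp only [map_sub, map_add, coeff_ofNat_mul, coeff_one, if_neg hm0,
    (hx.mul hx).coeff_eq_zero (n := m) (by rw [hm3]; decide),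
    (hy.mul hD).coeff_eq_zero (n := m) (by rw [hm3]; decide),
    (hx.mul hy).coeff_eq_zero (n := m) (by rw [hm3]; decide)] at hcoeff
  exact Int.modEq_iff_dvd.2 ⟨-f.coeff m, by linear_combination -hcoeff⟩

theorem gaussTheta_sq :
    gaussTheta ^ 2 = expand 9 (by decide) (gaussTheta ^ 2) +
      4 * (halfThetaPrimeToThree * expand 9 (by decide) gaussTheta) +
        4 * halfThetaPrimeToThree ^ 2 := by
  rw [map_pow]
  linear_combination (gaussTheta + expand 9 (by decide) gaussTheta + 2 * halfThetaPrimeToThree) *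
    gaussTheta_eq_expand_add

theorem coeff_gaussTheta_sq_of_mod_three_eq_one {m : ℕ} (hm : m % 3 = 1) :
    (gaussTheta ^ 2).coeff m =
      4 * (halfThetaPrimeToThree * expand 9 (by decide) gaussTheta).coeff m := by
  have hx := isSupportedMod_halfThetaPrimeToThree
  have hm3 : (m : ZMod 3) = 1 := by rw [← ZMod.natCast_mod, hm, Nat.cast_one]
  have h9 : ¬ 9 ∣ m := by omega
  have hzero : (halfThetaPrimeToThree ^ 2).coeff m = 0 := by
    rw [sq]
    exact (hx.mul hx).coeff_eq_zero (by rw [hm3]; decide)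
  rw [gaussTheta_sq, map_add, map_add, coeff_expand_of_not_dvd _ _ _ h9, coeff_ofNat_mul,
    coeff_ofNat_mul, hzero]
  ring

theorem coeff_gaussTheta_sq_of_mod_three_eq_two {m : ℕ} (hm : m % 3 = 2) :
    (gaussTheta ^ 2).coeff m = 4 * (halfThetaPrimeToThree ^ 2).coeff m := by
  have hx := isSupportedMod_halfThetaPrimeToThree
  have hm3 : (m : ZMod 3) = 2 := by rw [← ZMod.natCast_mod, hm, Nat.cast_ofNat]
  have h9 : ¬ 9 ∣ m := by omega
  have hzero : (halfThetaPrimeToThree * expand 9 (by decide) gaussTheta).coeff m = 0 :=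
    (hx.mul (.expand_of_dvd (by decide) _ _)).coeff_eq_zero (by rw [hm3]; decide)
  rw [gaussTheta_sq, map_add, map_add, coeff_expand_of_not_dvd _ _ _ h9, coeff_ofNat_mul,
    coeff_ofNat_mul, hzero]
  ring

theorem even_coeff_sq {f : ℤ⟦X⟧} {n : ℕ} (hn : Odd n) : Even ((f ^ 2).coeff n) := by
  let g := f.map (Int.castRingHom (ZMod 2))
  have hfrob : (expand 2 two_ne_zero g).map (frobenius (ZMod 2) 2) = g ^ 2 :=
    MvPowerSeries.map_frobenius_expand ..
  have hsq : (g ^ 2).coeff n = 0 := by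
    rw [← hfrob, coeff_map, coeff_expand_of_not_dvd _ _ _ hn.not_two_dvd_nat, map_zero]
  rw [← map_pow, coeff_map] at hsq
  simpa [ZMod.intCast_eq_zero_iff_even] using hsq

theorem two_mul_coeff_biregularSeries_modEq {m : ℕ} (hm : m % 3 = 1) :
    2 * (biregularSeries 2 9).coeff m ≡ -(gaussTheta ^ 2).coeff m [ZMOD 16] := by
  convert! (coeff_biregularSeries_modEq hm).mul_left' (c := 2) using 1
  rw [coeff_gaussTheta_sq_of_mod_three_eq_one hm]
  ring

theorem eight_dvd_coeff_gaussTheta_sq {m : ℕ} (hm : m % 6 = 5) :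
    8 ∣ (gaussTheta ^ 2).coeff m := by
  rw [coeff_gaussTheta_sq_of_mod_three_eq_two (by omega)]
  have hodd : Odd m := Nat.odd_iff.2 (by omega)
  exact mul_dvd_mul_left 4 (even_coeff_sq hodd).two_dvd

end Dissection

section SumTwoSquares

/-- The number of representations of `m` as a sum of two squares of integers, counted as the number
of Gaussian integers of norm `m`. -/
noncomputable def sumTwoSquaresCount (m : ℕ) : ℕ :=
  {z : GaussianInt | z.norm = m}.ncard

theorem mem_Icc_of_sq_le {x n : ℤ} (hx : x ^ 2 ≤ n) : x ∈ Set.Icc (-n) n :=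
  ⟨by linarith [Int.le_self_sq (-x)], by linarith [Int.le_self_sq x]⟩

instance finite_int_sq_eq (n : ℕ) : Finite {x : ℤ // x ^ 2 = n} :=
  Set.Finite.to_subtype <| (Set.finite_Icc (-n : ℤ) n).subset fun _ hx => mem_Icc_of_sq_le hx.le

theorem coeff_gaussTheta (n : ℕ) :
    gaussTheta.coeff n = (-1) ^ n * Nat.card {x : ℤ // x ^ 2 = n} := by
  simp only [gaussTheta, map_add, coeff_one, coeff_ofNat_mul, halfTheta, coeff_mk]
  rcases eq_or_ne n 0 with rfl | hn
  · simp
  by_cases hsq : IsSquare n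
  · obtain ⟨r, rfl⟩ := hsq
    have hr : (r : ℤ) ≠ -r := by
      have : r ≠ 0 := left_ne_zero_of_mul hn
      omega
    have hroots : {x : ℤ | x ^ 2 = ↑(r * r)} = {(r : ℤ), -(r : ℤ)} := by
      ext x
      rw [Nat.cast_mul, ← sq]
      exact sq_eq_sq_iff_eq_or_eq_neg
    have hcard : Nat.card {x : ℤ // x ^ 2 = ↑(r * r)} = 2 :=
      (Nat.card_coe_set_eq {x : ℤ | x ^ 2 = ↑(r * r)}).trans (by rw [hroots, Set.ncard_pair hr])
    rw [if_neg hn, if_pos ⟨hn, r, rfl⟩, hcard]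
    ring
  · have : IsEmpty {x : ℤ // x ^ 2 = n} :=
      ⟨fun x => hsq ⟨x.1.natAbs, by zify; rw [← sq, sq_abs, x.2]⟩⟩
    simp [hn, hsq]

theorem sumTwoSquaresCount_eq_sum_antidiagonal (m : ℕ) :
    sumTwoSquaresCount m = ∑ ij ∈ Finset.HasAntidiagonal.antidiagonal m,
      Nat.card {x : ℤ // x ^ 2 = ij.1} * Nat.card {y : ℤ // y ^ 2 = ij.2} := by
  let squares (z : {z : GaussianInt // z.norm = m}) : Finset.HasAntidiagonal.antidiagonal m :=
    ⟨(z.1.re.natAbs ^ 2, z.1.im.natAbs ^ 2), by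
      have hz := z.2
      rw [Zsqrtd.norm_def] at hz
      rw [Finset.HasAntidiagonal.mem_antidiagonal]
      zify
      simp only [sq_abs]
      linarith⟩
  let e (ij : Finset.HasAntidiagonal.antidiagonal m) : {z // squares z = ij} ≃
      {x : ℤ // x ^ 2 = ij.1.1} × {y : ℤ // y ^ 2 = ij.1.2} :=
    { toFun := fun z => (⟨z.1.1.re, by simp [← z.2, squares]⟩, ⟨z.1.1.im, by simp [← z.2, squares]⟩)
      invFun := fun xy =>
        ⟨⟨⟨xy.1, xy.2⟩, by
          have hij : (ij.1.1 + ij.1.2 : ℤ) = m :=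
            mod_cast Finset.HasAntidiagonal.mem_antidiagonal.1 ij.2
          rw [Zsqrtd.norm_def]
          linear_combination xy.1.2 + xy.2.2 + hij⟩,
        Subtype.ext <| Prod.ext (by zify; simp [squares, xy.1.2]) (by zify; simp [squares, xy.2.2])⟩
      left_inv := fun _ => rfl
      right_inv := fun _ => rfl }
  have (ij : Finset.HasAntidiagonal.antidiagonal m) : Finite {z // squares z = ij} :=
    .of_equiv _ (e ij).symm
  rw [sumTwoSquaresCount, ← Nat.card_coe_set_eq, ← Finset.sum_coe_sort]
  refine (Nat.card_congr (Equiv.sigmaFiberEquiv squares).symm).trans (Nat.card_sigma.trans ?_)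
  exact Finset.sum_congr rfl fun ij _ => (Nat.card_congr (e ij)).trans (Nat.card_prod _ _)

theorem coeff_gaussTheta_sq (m : ℕ) :
    (gaussTheta ^ 2).coeff m = (-1) ^ m * sumTwoSquaresCount m := by
  rw [sumTwoSquaresCount_eq_sum_antidiagonal, Nat.cast_sum, Finset.mul_sum, sq, coeff_mul]
  refine Finset.sum_congr rfl fun ij hij => ?_
  rw [← Finset.HasAntidiagonal.mem_antidiagonal.1 hij, pow_add, coeff_gaussTheta, coeff_gaussTheta]
  push_cast
  ring

theorem two_mul_biregularOverpartitionCount_modEq {m : ℕ} (hm : m % 6 = 1) :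
    2 * (biregularOverpartitionCount 2 9 m : ℤ) ≡ sumTwoSquaresCount m [ZMOD 16] := by
  have hodd : Odd m := Nat.odd_iff.2 (by omega)
  simpa [biregularSeries, coeff_gaussTheta_sq, hodd.neg_one_pow] using
    two_mul_coeff_biregularSeries_modEq (m := m) (by omega)

theorem two_dvd_biregularOverpartitionCount {m : ℕ} (hm : m % 3 = 1) :
    (2 : ℤ) ∣ biregularOverpartitionCount 2 9 m := by
  have h := (coeff_biregularSeries_modEq hm).of_dvd (show (2 : ℤ) ∣ 8 by decide)
  simpa [biregularSeries] using h.dvd_iff.2 ⟨_, (neg_mul_comm 2 _)⟩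

theorem eight_dvd_sumTwoSquaresCount {m : ℕ} (hm : m % 6 = 5) : (8 : ℤ) ∣ sumTwoSquaresCount m := by
  have hodd : Odd m := Nat.odd_iff.2 (by omega)
  simpa [coeff_gaussTheta_sq, hodd.neg_one_pow] using eight_dvd_coeff_gaussTheta_sq hm

end SumTwoSquares

section HeckeRelation

theorem finite_norm_eq (m : ℕ) : {z : GaussianInt | z.norm = m}.Finite := by
  have hbox := (Set.finite_Icc (-m : ℤ) m).prod (Set.finite_Icc (-m : ℤ) m)
  refine (hbox.image fun x => ⟨x.1, x.2⟩).subset fun z (hz : z.norm = m) => ?_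
  rw [Zsqrtd.norm_def] at hz
  have hre : z.re ^ 2 ≤ m := by linarith [mul_self_nonneg z.im]
  have him : z.im ^ 2 ≤ m := by linarith [mul_self_nonneg z.re]
  exact ⟨(z.re, z.im), ⟨mem_Icc_of_sq_le hre, mem_Icc_of_sq_le him⟩, rfl⟩

theorem ncard_norm_eq_mul_and_dvd {w : GaussianInt} {k : ℕ} (hk : k ≠ 0) (hw : w.norm = k)
    (n : ℕ) :
    {z : GaussianInt | z.norm = ↑(k * n) ∧ w ∣ z}.ncard = sumTwoSquaresCount n := by
  have hk' : (k : ℤ) ≠ 0 := mod_cast hk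
  have hw0 : w ≠ 0 := by
    rintro rfl
    exact hk' (by simpa using hw.symm)
  have himage : {z : GaussianInt | z.norm = ↑(k * n) ∧ w ∣ z} =
      (w * ·) '' {z : GaussianInt | z.norm = n} := by
    ext z
    constructor
    · rintro ⟨hz, y, rfl⟩
      refine ⟨y, mul_left_cancel₀ hk' ?_, rfl⟩
      rw [← hw, ← Zsqrtd.norm_mul, hz, hw, Nat.cast_mul]
    · rintro ⟨y, hy, rfl⟩
      refine ⟨?_, dvd_mul_right w y⟩
      rw [Zsqrtd.norm_mul, hw, show y.norm = n from hy, Nat.cast_mul]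
  rw [himage, Set.ncard_image_of_injective _ (mul_right_injective₀ hw0), sumTwoSquaresCount]

theorem prime_of_prime_norm {w : GaussianInt} (hw : Prime w.norm) : Prime w := by
  have : IsLocalHom (Zsqrtd.normMonoidHom (d := -1)) :=
    ⟨fun z hz => (Zsqrtd.isUnit_iff_norm_isUnit z).2 hz⟩
  exact (Irreducible.of_map (f := Zsqrtd.normMonoidHom) hw.irreducible).prime

theorem dvd_or_star_dvd_of_dvd_norm {w z : GaussianInt} (hw : Prime w)
    (h : w ∣ (z.norm : GaussianInt)) : w ∣ z ∨ star w ∣ z := by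
  rw [Zsqrtd.norm_eq_mul_conj] at h
  exact (hw.dvd_or_dvd h).imp_right fun h => star_star z ▸ map_dvd (starRingEnd GaussianInt) h

theorem sumTwoSquaresCount_sq_mul_of_inert {p : ℕ} (hp : p.Prime) (hp4 : p % 4 = 3) (m : ℕ) :
    sumTwoSquaresCount (p ^ 2 * m) = sumTwoSquaresCount m := by
  have := Fact.mk hp
  have hprime : Prime (p : GaussianInt) := GaussianInt.prime_of_nat_prime_of_mod_four_eq_three p hp4
  have hnorm : (p : GaussianInt).norm = ↑(p ^ 2) := by simp [Zsqrtd.norm_natCast, sq]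
  rw [← ncard_norm_eq_mul_and_dvd (pow_ne_zero 2 hp.ne_zero) hnorm m, sumTwoSquaresCount]
  congr 1
  ext z
  refine ⟨fun hz => ⟨hz, ?_⟩, And.left⟩
  have hdvd : (p : GaussianInt) ∣ (z.norm : GaussianInt) := by
    rw [show z.norm = _ from hz]
    exact ⟨p * m, by push_cast; ring⟩
  simpa using dvd_or_star_dvd_of_dvd_norm hprime hdvd

theorem isCoprime_star_of_norm_eq {p : ℕ} (hp : p.Prime) (hp2 : p ≠ 2) {w : GaussianInt}
    (hw : w.norm = p) : IsCoprime w (star w) := by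
  have hpz : Prime (p : ℤ) := Nat.prime_iff_prime_int.1 hp
  have hwprime : Prime w := prime_of_prime_norm (hw ▸ hpz)
  refine hwprime.coprime_iff_not_dvd.2 fun hdvd => ?_
  have htrace : w ∣ ((2 * w.re : ℤ) : GaussianInt) := by
    convert! dvd_add (dvd_refl w) hdvd using 1
    ext <;> simp [two_mul]
  have hnorm : (p : ℤ) ∣ 2 * w.re * (2 * w.re) := by
    rw [← Zsqrtd.norm_intCast (d := -1), ← hw]
    exact map_dvd Zsqrtd.normMonoidHom htrace
  have hp_not_dvd_two : ¬ (p : ℤ) ∣ 2 :=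
    mod_cast mt (Nat.prime_dvd_prime_iff_eq hp Nat.prime_two).1 hp2
  obtain ⟨x, hx⟩ : (p : ℤ) ∣ w.re :=
    (hpz.dvd_or_dvd (or_self_iff.1 (hpz.dvd_or_dvd hnorm))).resolve_left hp_not_dvd_two
  rw [Zsqrtd.norm_def] at hw
  obtain ⟨y, hy⟩ : (p : ℤ) ∣ w.im := hpz.dvd_of_dvd_pow (n := 2)
    ⟨1 - w.re * x, by linear_combination hw - w.re * hx⟩
  refine hpz.not_isUnit (.of_mul_eq_one (x * x + y * y) (mul_left_cancel₀ hpz.ne_zero ?_))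
  linear_combination hw - (w.re + p * x) * hx - (w.im + p * y) * hy

theorem sumTwoSquaresCount_sq_mul_of_split {p : ℕ} (hp : p.Prime) (hp4 : p % 4 = 1) (m : ℕ) :
    sumTwoSquaresCount (p ^ 2 * m) + sumTwoSquaresCount m = 2 * sumTwoSquaresCount (p * m) := by
  have := Fact.mk hp
  obtain ⟨a, b, hab⟩ := Nat.Prime.sq_add_sq (p := p) (by omega)
  let w : GaussianInt := ⟨a, b⟩
  have hw : w.norm = p := by rw [Zsqrtd.norm_def, ← hab]; push_cast; ring
  have hwstar : (star w).norm = p := (Zsqrtd.norm_conj w).trans hw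
  have hwprime : Prime w := prime_of_prime_norm (hw ▸ Nat.prime_iff_prime_int.1 hp)
  have hww : w * star w = p := by rw [← Zsqrtd.norm_eq_mul_conj, hw, Int.cast_natCast]
  have hnorm : (p : GaussianInt).norm = ↑(p ^ 2) := by simp [Zsqrtd.norm_natCast, sq]
  let N (w : GaussianInt) : Set GaussianInt := {z | z.norm = ↑(p ^ 2 * m) ∧ w ∣ z}
  have hcard {w : GaussianInt} (hw : w.norm = p) : (N w).ncard = sumTwoSquaresCount (p * m) := by
    rw [← ncard_norm_eq_mul_and_dvd hp.ne_zero hw, ← mul_assoc, ← sq]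
  have hunion : N w ∪ N (star w) = {z : GaussianInt | z.norm = ↑(p ^ 2 * m)} := by
    ext z
    refine ⟨fun hz => hz.elim And.left And.left, fun hz => ?_⟩
    have hdvd : w ∣ (z.norm : GaussianInt) := by
      rw [show z.norm = _ from hz]
      exact ⟨star w * (p * m), by push_cast; rw [← hww]; ring⟩
    exact (dvd_or_star_dvd_of_dvd_norm hwprime hdvd).imp (⟨hz, ·⟩) (⟨hz, ·⟩)
  have hinter : N w ∩ N (star w) = N p := by
    ext z
    rw [← hww]
    exact ⟨fun hz => ⟨hz.1.1, (isCoprime_star_of_norm_eq hp (by omega) hw).mul_dvd hz.1.2 hz.2.2⟩,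
      fun hz => ⟨⟨hz.1, dvd_of_mul_right_dvd hz.2⟩, ⟨hz.1, dvd_of_mul_left_dvd hz.2⟩⟩⟩
  have hfin (w : GaussianInt) : (N w).Finite := (finite_norm_eq _).subset fun _ => And.left
  calc
    _ = (N w ∪ N (star w)).ncard + (N w ∩ N (star w)).ncard := by
      rw [hunion, hinter, ncard_norm_eq_mul_and_dvd (pow_ne_zero 2 hp.ne_zero) hnorm m,
        sumTwoSquaresCount]
    _ = (N w).ncard + (N (star w)).ncard := Set.ncard_union_add_ncard_inter _ _ (hfin _) (hfin _)
    _ = _ := by rw [hcard hw, hcard hwstar, two_mul]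

end HeckeRelation

theorem biregularOverpartitionCount_sq_mul {p m : ℕ} (hp : p.Prime) (hp6 : p % 6 = 5)
    (hm : m % 6 = 1) :
    (biregularOverpartitionCount 2 9 (p ^ 2 * m) : ℤ) ≡
      -p * biregularOverpartitionCount 2 9 m [ZMOD 8] := by
  have hpm : p * m % 6 = 5 := by simp [Nat.mul_mod, hp6, hm]
  have hppm : p ^ 2 * m % 6 = 1 := by simp [sq, Nat.mul_mod, hp6, hm]
  have hB := two_mul_biregularOverpartitionCount_modEq hppm
  have hb := two_mul_biregularOverpartitionCount_modEq hm
  obtain ⟨b, h2b⟩ := two_dvd_biregularOverpartitionCount (m := m) (by omega)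
  rw [h2b] at hb ⊢
  -- As `B m` is even, only the residue of `-p` modulo `4` matters.
  have hneg {c : ℤ} (hc : -(p : ℤ) ≡ c [ZMOD 4]) : c * (2 * b) ≡ -p * (2 * b) [ZMOD 8] :=
    (hc.symm.mul_right' (c := 2 * b)).of_dvd ⟨b, by ring⟩
  have hp4 : p % 4 = 1 ∨ p % 4 = 3 := Nat.odd_mod_four_iff.1 (by omega)
  rcases hp4 with hp4 | hp4
  · have hsplit := sumTwoSquaresCount_sq_mul_of_split hp hp4 m
    have hr₂ := eight_dvd_sumTwoSquaresCount hpm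
    refine .trans ?_ (hneg (c := -1) (by simp only [Int.ModEq]; omega))
    simp only [Int.ModEq] at *
    omega
  · rw [sumTwoSquaresCount_sq_mul_of_inert hp hp4 m] at hB
    refine .trans ?_ (hneg (c := 1) (by simp only [Int.ModEq]; omega))
    simp only [Int.ModEq] at *
    omega

theorem biregularOverpartitionCount_pow_mul {p m : ℕ} (hp : p.Prime) (hp6 : p % 6 = 5)
    (hm : m % 6 = 1) (k : ℕ) :
    (biregularOverpartitionCount 2 9 (p ^ (2 * k) * m) : ℤ) ≡
      (-p) ^ k * biregularOverpartitionCount 2 9 m [ZMOD 8] := by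
  induction k with
  | zero => simp
  | succ k ih =>
    have hmod : p ^ (2 * k) * m % 6 = 1 := by simp [Nat.mul_mod, pow_mul, Nat.pow_mod, hp6, hm]
    rw [mul_add_one, add_comm, pow_add, mul_assoc, pow_succ' (-(p : ℤ)), mul_assoc]
    exact (biregularOverpartitionCount_sq_mul hp hp6 hmod).trans (ih.mul_left _)

theorem theorem3p4 (p : ℕ) (hp : p.Prime) (hp6 : p ≡ 5 [MOD 6]) :
    (∀ k r n : ℕ, 0 < k → p ∣ 6 * r + 5 →
      (biregularOverpartitionCount 2 9 (6 * p ^ (k + 1) * n + 6 * p * r + 5 * p) : ℤ) ≡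
        (-(p : ℤ)) *
          (biregularOverpartitionCount 2 9 (6 * p ^ (k - 1) * n + (6 * r + 5) / p) : ℤ) [ZMOD 8]) ∧
    (∀ k n : ℕ, 0 < k →
      (biregularOverpartitionCount 2 9 (6 * p ^ (2 * k) * n + p ^ (2 * k)) : ℤ) ≡
        (-(p : ℤ)) ^ k * (biregularOverpartitionCount 2 9 (6 * n + 1) : ℤ) [ZMOD 8]) := by
  refine ⟨fun k r n hk ⟨s, hs⟩ => ?_, fun k n _ => ?_⟩
  · obtain ⟨k, rfl⟩ := Nat.exists_eq_add_one.2 hk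
    have hs6 : s % 6 = 1 := by
      have h : p * s % 6 = 5 := by omega
      rw [Nat.mul_mod, show p % 6 = 5 from hp6] at h
      omega
    have hindex : 6 * p ^ (k + 1 + 1) * n + 6 * p * r + 5 * p = p ^ 2 * (6 * p ^ k * n + s) := by
      linear_combination p * hs
    rw [hs, Nat.mul_div_cancel_left _ hp.pos, Nat.add_sub_cancel, hindex]
    exact biregularOverpartitionCount_sq_mul hp hp6 (by rw [mul_assoc]; omega)
  · have hindex : 6 * p ^ (2 * k) * n + p ^ (2 * k) = p ^ (2 * k) * (6 * n + 1) := by ring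
    rw [hindex]
    exact biregularOverpartitionCount_pow_mul hp hp6 (by omega) k
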